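/- A graphon is a symmetric measurable function $W:[0,1]^2\to[0,1]$. It is piecewise Lipschitz if there are a constant $L$ and points $0=\alpha_0<\alpha_1<\dots<\alpha_{K+1}=1$ such that $|W(x,y)-W(x',y')|\le L(|x-x'|+|y-y'|)$ whenever $(x,y)$ and $(x',y')$ lie in the same block $[\alpha_{k-1},\alpha_k)\times[\alpha_{l-1},\alpha_l)$. For each $N$, let $X_1\le\dots\le X_N$ be the order statistics of $N$ independent uniform random variables on $[0,1]$. Let $\bar G_N$ be the weighted graph with adjacency matrix $[\bar A_N]_{ij}=W(X_i,X_j)$. Let $G_N$ be the random simple graph on $\{1,\dots,N\}$ in which, conditionally on $X_1,\dots,X_N$, the edges $ij$, $i<j$, are present independently with probabilities $W(X_i,X_j)$. The samples for different $N$ are defined on a common probability space, with an arbitrary joint distribution. The Laplacian of a weighted adjacency matrix $A$ is $D-A$, where $D$ is the diagonal matrix of the row sums of $A$. If $\lambda_1\le\dots\le\lambda_N$ and $\bar\lambda_1\le\dots\le\bar\lambda_N$ are the Laplacian eigenvalues of $G_N$ and of $\bar G_N$, counted with multiplicity, put $\mu_i=\lambda_i/N$ and $\bar\mu_i=\bar\lambda_i/N$.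 Suppose that $W$ has infimum $\eta_W>0$ on $[0,1]^2$, or that $W$ is piecewise Lipschitz, or that $W$ is continuous. Then, as $N\to\infty$, $$\max_{i=1,\dots,N}|\mu_i-\bar\mu_i| = O\!\left(\sqrt{\frac{\log N}{N}}\right)\quad\text{almost surely},$$ and in particular $$|\mu_2-\bar\mu_2| = O\!\left(\sqrt{\frac{\log N}{N}}\right)\quad\text{almost surely}.$$ -/

import Mathlib

open MeasureTheory ProbabilityTheory Filter Asymptotics
open scoped unitInterval

/-- A graphon: a symmetric (Lebesgue) measurable function `[0,1]² → [0,1]`. -/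
structure Graphon where
  toFun : I → I → ℝ
  symm' : ∀ x y, toFun x y = toFun y x
  nonneg' : ∀ x y, 0 ≤ toFun x y
  le_one' : ∀ x y, toFun x y ≤ 1
  aemeasurable' : AEMeasurable (fun p : I × I => toFun p.1 p.2) volume

namespace Graphon

instance : CoeFun Graphon (fun _ => I → I → ℝ) := ⟨Graphon.toFun⟩

/-- `W` is bounded away from zero: its infimum over the unit square is positive. -/
def HasPosInf (W : Graphon) : Prop := 0 < ⨅ p : I × I, W p.1 p.2

/-- `W` is piecewise Lipschitz: there are breakpoints `0 = α₀ < α₁ < ⋯ < α_{K+1} = 1` and a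
constant `L` such that `W` is `L`-Lipschitz for the `ℓ¹` distance on each block
`[α_{k-1}, α_k) × [α_{l-1}, α_l)`. -/
def PiecewiseLipschitz (W : Graphon) : Prop :=
  ∃ (L : ℝ) (K : ℕ) (α : Fin (K + 2) → ℝ),
    StrictMono α ∧ α 0 = 0 ∧ α (Fin.last (K + 1)) = 1 ∧
    ∀ (k l : Fin (K + 1)) (x x' y y' : I),
      (x : ℝ) ∈ Set.Ico (α k.castSucc) (α k.succ) →
      (x' : ℝ) ∈ Set.Ico (α k.castSucc) (α k.succ) →
      (y : ℝ) ∈ Set.Ico (α l.castSucc) (α l.succ) →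
      (y' : ℝ) ∈ Set.Ico (α l.castSucc) (α l.succ) →
      |W x y - W x' y'| ≤ L * (|(x : ℝ) - x'| + |(y : ℝ) - y'|)

/-- `W` is continuous on the unit square. -/
def IsContinuous (W : Graphon) : Prop := Continuous (fun p : I × I => W p.1 p.2)

/-- The adjacency matrix `(W(xᵢ, xⱼ))ᵢⱼ` of the weighted graph with latent variables `x`. -/
def weightedAdj (W : Graphon) {N : ℕ} (x : Fin N → I) : Matrix (Fin N) (Fin N) ℝ :=
  Matrix.of fun i j => W (x i) (x j)

lemma weightedAdj_isSymm (W : Graphon) {N : ℕ} (x : Fin N → I) : (W.weightedAdj x).IsSymm :=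
  Matrix.IsSymm.ext fun i j => W.symm' (x j) (x i)

end Graphon

/-- The order statistics of the tuple `u`: its entries rearranged in non-decreasing order. -/
noncomputable def orderStat {N : ℕ} (u : Fin N → I) : Fin N → I := u ∘ Tuple.sort u

/-- The probability of the simple graph `H` on `N` vertices when, for every `i < j`, the edge
`ij` is drawn independently with probability `W(xᵢ, xⱼ)`. -/
noncomputable def Graphon.graphProb (W : Graphon) {N : ℕ} (x : Fin N → I)
    (H : SimpleGraph (Fin N)) : ℝ :=
  open Classical in
  ∏ p : Fin N × Fin N with p.1 < p.2,
    if H.Adj p.1 p.2 then W (x p.1) (x p.2) else 1 - W (x p.1) (x p.2)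

/-- `G` is the random simple graph on `N` vertices sampled from `W` with latent variables the
order statistics `X` of the i.i.d. uniform random variables `U`: conditionally on `X`, the edges
are independent and `ij` is present with probability `W(Xᵢ, Xⱼ)`. -/
structure IsSampledGraph {Ω : Type*} [MeasurableSpace Ω] (P : Measure Ω) (W : Graphon) (N : ℕ)
    (U : Fin N → Ω → I) (G : Ω → SimpleGraph (Fin N)) : Prop where
  measurable_latent : ∀ i, Measurable (U i)
  uniform_latent : ∀ i, P.map (U i) = volume
  indep_latent : iIndepFun U P
  measurableSet_graph : ∀ H : SimpleGraph (Fin N), MeasurableSet {ω | G ω = H}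
  condProb_graph : ∀ H : SimpleGraph (Fin N),
    P[Set.indicator {ω | G ω = H} (fun _ => (1 : ℝ)) |
        MeasurableSpace.comap (fun ω => orderStat (fun i => U i ω)) inferInstance]
      =ᵐ[P] fun ω => W.graphProb (orderStat (fun i => U i ω)) H

/-- The Laplacian `D - A` of a weighted adjacency matrix `A`, where `D` is the diagonal matrix of
the row sums of `A`. -/
def weightedLaplacian {N : ℕ} (A : Matrix (Fin N) (Fin N) ℝ) : Matrix (Fin N) (Fin N) ℝ :=
  Matrix.diagonal (fun i => ∑ j, A i j) - A

lemma weightedLaplacian_isHermitian {N : ℕ} {A : Matrix (Fin N) (Fin N) ℝ} (hA : A.IsSymm) :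
    (weightedLaplacian A).IsHermitian := by
  unfold weightedLaplacian
  refine (Matrix.isHermitian_diagonal _).sub ?_
  rw [Matrix.IsHermitian, Matrix.conjTranspose_eq_transpose_of_trivial]
  exact hA

/-- The normalized Laplacian eigenvalues `μᵢ = λᵢ / N`, where `λ₁ ≤ ⋯ ≤ λ_N` are the eigenvalues
of the Laplacian, with multiplicity, in non-decreasing order (here indexed from `0`;
`eigenvalues₀` is in non-increasing order). -/
noncomputable def normalizedEigenvalue {N : ℕ} {A : Matrix (Fin N) (Fin N) ℝ} (hA : A.IsSymm)
    (i : Fin N) : ℝ :=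
  (weightedLaplacian_isHermitian hA).eigenvalues₀ (Fin.cast (Fintype.card_fin N).symm i.rev) / N

/-- The eigenvalues `μᵢ` of the sampled simple graph. -/
noncomputable def graphEigenvalue {N : ℕ} (G : SimpleGraph (Fin N)) (i : Fin N) : ℝ :=
  open Classical in normalizedEigenvalue (G.isSymm_adjMatrix (α := ℝ)) i

/-- The eigenvalues `μ̄ᵢ` of the weighted graph with latent variables `x`. -/
noncomputable def Graphon.weightedEigenvalue (W : Graphon) {N : ℕ} (x : Fin N → I) (i : Fin N) :
    ℝ :=
  normalizedEigenvalue (W.weightedAdj_isSymm x) i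

/-!
Conditionally on the latent variables, the difference of the two Laplacians is a matrix built from
independent centred edges. Write `L` and `L'` for the Laplacians of the simple graph and of the
weighted graph. By Weyl's perturbation inequality
(`Matrix.IsHermitian.abs_eigenvalues₀_sub_le`) it is enough to bound `vᵀ (L - L') v` by
`O(√(N log N))` uniformly over unit vectors `v`; dividing by `N` gives the rate. The diagonal
entries `W (X i) (X i)` cancel in a Laplacian.

The quadratic form splits into a degree part and an adjacency part
(`Graphon.dotProduct_laplacian_sub`). The first is an average, with weights `v k ^ 2`, of the
centred degrees; the second is the quadratic form of the centred adjacency matrix. For fixed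
coefficients both are centred linear statistics of the edges (`Graphon.edgeDeviation`), and these
have sub-Gaussian tails (`IsSampledGraph.measureReal_le_abs_edgeDeviation_le`), with variance
proxy `O(N)` for a degree and `O(1)` for the adjacency form at a bounded vector. A union bound over
the `N` degrees costs a factor `N`. For the adjacency form a union bound is taken over the points of
a lattice of mesh `1 / N ^ 2`: there are at most `(2 N ^ 2 + 1) ^ N ≤ exp (4 N log N)` of them, which
the tail at `40 √(N log N)` absorbs, and rounding `v` to the lattice changes the form by at most `4`
(`Graphon.abs_edgeDeviation_adjCoeff_le`). The exceptional probabilities are at most `4 / N ^ 2`, so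
Borel–Cantelli concludes whatever the joint law of the samples for different `N`.
-/

/-! ### Weyl's perturbation inequality -/

theorem LinearMap.IsSymmetric.inner_apply_self_eq_sum {E : Type*} [NormedAddCommGroup E]
    [InnerProductSpace ℝ E] [FiniteDimensional ℝ E] {T : E →ₗ[ℝ] E} (hT : T.IsSymmetric) {n : ℕ}
    (hn : Module.finrank ℝ E = n) (x : E) :
    inner ℝ (T x) x =
      ∑ k, hT.eigenvalues hn k * inner ℝ (hT.eigenvectorBasis hn k) x ^ 2 := by
  rw [← (hT.eigenvectorBasis hn).sum_inner_mul_inner]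
  refine Finset.sum_congr rfl fun k _ => ?_
  rw [hT x, hT.apply_eigenvectorBasis hn k, inner_smul_right,
    real_inner_comm x (hT.eigenvectorBasis hn k)]
  simp
  ring

/-- One half of Weyl's perturbation inequality: the `i`-th largest eigenvalue is monotone, with
slack `τ`, in the quadratic form. The vectors orthogonal to the eigenvectors of `S` of index `> i`
and to those of `T` of index `< i` satisfy only `n - 1` linear conditions, so there is a unit
vector among them; its Rayleigh quotients for `S` and `T` separate the two eigenvalues. -/
theorem LinearMap.IsSymmetric.eigenvalues_le_add_of_inner_le {E : Type*} [NormedAddCommGroup E]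
    [InnerProductSpace ℝ E] [FiniteDimensional ℝ E] {S T : E →ₗ[ℝ] E} (hS : S.IsSymmetric)
    (hT : T.IsSymmetric) {n : ℕ} (hn : Module.finrank ℝ E = n) {τ : ℝ}
    (h : ∀ x, ‖x‖ = 1 → inner ℝ (S x) x ≤ inner ℝ (T x) x + τ) (i : Fin n) :
    hS.eigenvalues hn i ≤ hT.eigenvalues hn i + τ := by
  let φ : E →ₗ[ℝ] ({k : Fin n // k ≠ i} → ℝ) := LinearMap.pi fun k =>
    if (k : Fin n) < i then (innerₗ E) (hT.eigenvectorBasis hn k)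
    else (innerₗ E) (hS.eigenvectorBasis hn k)
  have hker : LinearMap.ker φ ≠ ⊥ := by
    apply LinearMap.ker_ne_bot_of_finrank_lt
    have : 0 < n := i.pos
    simp [hn, Fintype.card_subtype_compl, this]
  obtain ⟨y, hy, hy0⟩ := Submodule.exists_mem_ne_zero_of_ne_bot hker
  set x : E := (‖y‖⁻¹ : ℝ) • y
  have hx : x ∈ LinearMap.ker φ := Submodule.smul_mem _ _ hy
  have hx1 : ‖x‖ = 1 := norm_smul_inv_norm hy0
  have hcomp : ∀ k : {k : Fin n // k ≠ i}, φ x k = 0 := fun k => by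
    rw [LinearMap.mem_ker.1 hx]; rfl
  have hTx : ∀ k, k < i → inner ℝ (hT.eigenvectorBasis hn k) x = 0 := fun k hk => by
    simpa [φ, hk] using hcomp ⟨k, hk.ne⟩
  have hSx : ∀ k, i < k → inner ℝ (hS.eigenvectorBasis hn k) x = 0 := fun k hk => by
    simpa [φ, hk.not_gt] using hcomp ⟨k, hk.ne'⟩
  have hsum : ∀ b : OrthonormalBasis (Fin n) ℝ E, ∑ k, inner ℝ (b k) x ^ 2 = 1 := fun b => by
    simpa [hx1] using b.sum_sq_norm_inner_right x
  have h1 : hS.eigenvalues hn i ≤ inner ℝ (S x) x := by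
    rw [hS.inner_apply_self_eq_sum hn, ← mul_one (hS.eigenvalues hn i),
      ← hsum (hS.eigenvectorBasis hn), Finset.mul_sum]
    refine Finset.sum_le_sum fun k _ => ?_
    rcases le_or_gt k i with hk | hk
    · exact mul_le_mul_of_nonneg_right (hS.eigenvalues_antitone hn hk) (sq_nonneg _)
    · simp [hSx k hk]
  have h2 : inner ℝ (T x) x ≤ hT.eigenvalues hn i := by
    rw [hT.inner_apply_self_eq_sum hn, ← mul_one (hT.eigenvalues hn i),
      ← hsum (hT.eigenvectorBasis hn), Finset.mul_sum]
    refine Finset.sum_le_sum fun k _ => ?_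
    rcases lt_or_ge k i with hk | hk
    · simp [hTx k hk]
    · exact mul_le_mul_of_nonneg_right (hT.eigenvalues_antitone hn hk) (sq_nonneg _)
  linarith [h x hx1]

theorem Matrix.IsHermitian.abs_eigenvalues₀_sub_le {n : Type*} [Fintype n] [DecidableEq n]
    {A B : Matrix n n ℝ} (hA : A.IsHermitian) (hB : B.IsHermitian) {τ : ℝ}
    (h : ∀ v : n → ℝ, ∑ i, v i ^ 2 = 1 → 
      |dotProduct v (A.mulVec v) - dotProduct v (B.mulVec v)| ≤ τ)
    (i : Fin (Fintype.card n)) : |hA.eigenvalues₀ i - hB.eigenvalues₀ i| ≤ τ := by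
  have key : ∀ x : EuclideanSpace ℝ n, ‖x‖ = 1 →
      |inner ℝ (A.toEuclideanLin x) x - inner ℝ (B.toEuclideanLin x) x| ≤ τ := fun x hx => by
    have hx' : ∑ i, x i ^ 2 = 1 := by
      have := EuclideanSpace.real_norm_sq_eq x
      rw [← this, hx, one_pow]
    simpa [PiLp.inner_apply, Matrix.toLpLin_apply, dotProduct, mul_comm] using h x hx'
  rw [abs_le]
  constructor
  · have := LinearMap.IsSymmetric.eigenvalues_le_add_of_inner_le (τ := τ)
      (isSymmetric_toEuclideanLin_iff.mpr hB) (isSymmetric_toEuclideanLin_iff.mpr hA)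
      finrank_euclideanSpace (fun x hx => by linarith [(abs_le.1 (key x hx)).1]) i
    unfold eigenvalues₀
    linarith
  · have := LinearMap.IsSymmetric.eigenvalues_le_add_of_inner_le (τ := τ)
      (isSymmetric_toEuclideanLin_iff.mpr hA) (isSymmetric_toEuclideanLin_iff.mpr hB)
      finrank_euclideanSpace (fun x hx => by linarith [(abs_le.1 (key x hx)).2]) i
    unfold eigenvalues₀
    linarith

/-! ### Linear statistics of the edges for fixed latent variables -/

/-- The pairs `(i, j)` with `i < j`: one for each potential edge on `N` vertices. -/
def vertexPairs (N : ℕ) : Finset (Fin N × Fin N) := {p | p.1 < p.2}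

open Classical in
/-- The centred linear statistic `∑_{i<j} c i j * (1[ij ∈ H] - W (x i) (x j))`. -/
noncomputable def Graphon.edgeDeviation (W : Graphon) {N : ℕ} (x : Fin N → I)
    (H : SimpleGraph (Fin N)) (c : Fin N × Fin N → ℝ) : ℝ :=
  ∑ p ∈ vertexPairs N, c p * ((if H.Adj p.1 p.2 then 1 else 0) - W (x p.1) (x p.2))

open Classical in
/-- Distributive law, with the subsets of `vertexPairs N` read as the simple graphs on `Fin N`. -/
theorem sum_prod_adj_ite {N : ℕ} (a b : Fin N × Fin N → ℝ) :
    ∑ H : SimpleGraph (Fin N), ∏ p ∈ vertexPairs N, (if H.Adj p.1 p.2 then a p else b p) =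
      ∏ p ∈ vertexPairs N, (a p + b p) := by
  rw [Finset.prod_add]
  refine Finset.sum_bij' (fun H _ => {p ∈ vertexPairs N | H.Adj p.1 p.2})
    (fun t _ => SimpleGraph.fromRel fun i j => (i, j) ∈ t) ?_ ?_ ?_ ?_ ?_
  · intro H _
    simp
  · simp
  · intro H _
    ext i j
    simp only [SimpleGraph.fromRel_adj, Finset.mem_filter, vertexPairs, Finset.mem_univ, true_and]
    constructor
    · rintro ⟨_, h | h⟩
      exacts [h.2, h.2.symm]
    · intro h
      refine ⟨h.ne, ?_⟩
      rcases lt_or_gt_of_ne h.ne with hlt | hlt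
      exacts [.inl ⟨hlt, h⟩, .inr ⟨hlt, h.symm⟩]
  · intro t ht
    have ht' := Finset.mem_powerset.1 ht
    ext ⟨i, j⟩
    simp only [SimpleGraph.fromRel_adj, Finset.mem_filter]
    constructor
    · rintro ⟨hp, _, h | h⟩
      · exact h
      · have h1 := ht' h
        simp only [vertexPairs, Finset.mem_filter, Finset.mem_univ, true_and] at hp h1
        exact absurd hp h1.not_gt
    · intro h
      have h1 := ht' h
      refine ⟨h1, ?_, .inl h⟩
      simp only [vertexPairs, Finset.mem_filter, Finset.mem_univ, true_and] at h1
      exact h1.ne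
  · intro H _
    rw [Finset.prod_ite]
    congr 1
    refine Finset.prod_congr ?_ fun _ _ => rfl
    ext p
    simp only [Finset.mem_filter, Finset.mem_sdiff]
    tauto

namespace Graphon

variable (W : Graphon) {N : ℕ} (x : Fin N → I)

open Classical in
theorem graphProb_eq (H : SimpleGraph (Fin N)) :
    W.graphProb x H = ∏ p ∈ vertexPairs N,
      if H.Adj p.1 p.2 then W (x p.1) (x p.2) else 1 - W (x p.1) (x p.2) := rfl

open Classical in
/-- The marginal of `graphProb` at a pair is the edge probability of that pair. -/
theorem sum_graphProb_adj {q : Fin N × Fin N} (hq : q ∈ vertexPairs N) :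
    ∑ H : SimpleGraph (Fin N), (if H.Adj q.1 q.2 then W.graphProb x H else 0) =
      W (x q.1) (x q.2) := by
  have h := sum_prod_adj_ite (N := N) (fun p => W (x p.1) (x p.2))
    (fun p => if p = q then 0 else 1 - W (x p.1) (x p.2))
  rw [Finset.prod_eq_single_of_mem q hq (fun p _ hp => by simp [hp])] at h
  simp only [if_true, add_zero] at h
  rw [← h]
  refine Finset.sum_congr rfl fun H _ => ?_
  by_cases hH : H.Adj q.1 q.2
  · rw [if_pos hH, graphProb_eq]
    refine Finset.prod_congr rfl fun p _ => ?_
    by_cases hp : p = q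
    · subst hp; simp [hH]
    · simp [hp]
  · rw [if_neg hH, Finset.prod_eq_zero hq]
    simp [hH]

theorem abs_edgeDeviation_le (H : SimpleGraph (Fin N)) (c : Fin N × Fin N → ℝ) :
    |W.edgeDeviation x H c| ≤ ∑ p ∈ vertexPairs N, |c p| := by
  refine (Finset.abs_sum_le_sum_abs _ _).trans (Finset.sum_le_sum fun p _ => ?_)
  rw [abs_mul]
  refine mul_le_of_le_one_right (abs_nonneg _) (abs_le.2 ?_)
  have h0 := W.nonneg' (x p.1) (x p.2)
  have h1 := W.le_one' (x p.1) (x p.2)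
  split_ifs <;> constructor <;> linarith

end Graphon

theorem Real.exp_le_add_exp_sq (x : ℝ) : Real.exp x ≤ x + Real.exp (x ^ 2) := by
  have hsq := Real.add_one_le_exp (x ^ 2)
  rcases le_or_gt |x| 1 with h | h
  · have := (abs_le.1 (Real.abs_exp_sub_one_sub_id_le h)).2
    linarith
  · rcases lt_abs.1 h with h | h
    · have : Real.exp x ≤ Real.exp (x ^ 2) := Real.exp_le_exp.2 (by nlinarith)
      linarith
    · have : Real.exp x ≤ 1 := Real.exp_le_one_iff.2 (by linarith)
      nlinarith

/-- Moment generating function of a centred Bernoulli variable. -/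
theorem Real.bernoulli_mgf_le {p : ℝ} (h0 : 0 ≤ p) (h1 : p ≤ 1) (c : ℝ) :
    p * Real.exp (c * (1 - p)) + (1 - p) * Real.exp (c * (0 - p)) ≤ Real.exp (c ^ 2) := by
  have e1 : Real.exp (c * (1 - p)) ≤ c * (1 - p) + Real.exp (c ^ 2) :=
    (Real.exp_le_add_exp_sq _).trans (add_le_add_right (Real.exp_le_exp.2 (by
      nlinarith [mul_nonneg (sq_nonneg c) (mul_nonneg h0 (by linarith : (0:ℝ) ≤ 2 - p))])) _)
  have e2 : Real.exp (c * (0 - p)) ≤ c * (0 - p) + Real.exp (c ^ 2) :=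
    (Real.exp_le_add_exp_sq _).trans (add_le_add_right (Real.exp_le_exp.2 (by
      nlinarith [mul_nonneg (sq_nonneg c) (by nlinarith : (0:ℝ) ≤ 1 - p ^ 2)])) _)
  nlinarith [mul_le_mul_of_nonneg_left e1 h0, mul_le_mul_of_nonneg_left e2 (sub_nonneg.2 h1)]

open Classical in
theorem Graphon.sum_graphProb_mul_exp_edgeDeviation_le (W : Graphon) {N : ℕ} (x : Fin N → I)
    (c : Fin N × Fin N → ℝ) :
    ∑ H, W.graphProb x H * Real.exp (W.edgeDeviation x H c) ≤
      Real.exp (∑ p ∈ vertexPairs N, c p ^ 2) := by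
  have h : ∀ H : SimpleGraph (Fin N), W.graphProb x H * Real.exp (W.edgeDeviation x H c) =
      ∏ p ∈ vertexPairs N, if H.Adj p.1 p.2
        then W (x p.1) (x p.2) * Real.exp (c p * (1 - W (x p.1) (x p.2)))
        else (1 - W (x p.1) (x p.2)) * Real.exp (c p * (0 - W (x p.1) (x p.2))) := fun H => by
    rw [Graphon.graphProb_eq, Graphon.edgeDeviation, Real.exp_sum, ← Finset.prod_mul_distrib]
    refine Finset.prod_congr rfl fun p _ => ?_
    split_ifs <;> rfl
  simp_rw [h]
  rw [sum_prod_adj_ite, Real.exp_sum]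
  refine Finset.prod_le_prod (fun p _ => ?_) fun p _ =>
    Real.bernoulli_mgf_le (W.nonneg' _ _) (W.le_one' _ _) _
  have h0 := W.nonneg' (x p.1) (x p.2)
  have h1 := sub_nonneg.2 (W.le_one' (x p.1) (x p.2))
  positivity

/-! ### Measurability of the order statistics -/

theorem measurable_orderStat {N : ℕ} :
    Measurable (orderStat : (Fin N → I) → Fin N → I) := by
  have hsort : ∀ π : Equiv.Perm (Fin N), MeasurableSet {u : Fin N → I | π = Tuple.sort u} := by
    intro π
    simp only [Tuple.eq_sort_iff, Monotone, Set.ofPred_and, Set.ofPred_forall]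
    refine .inter (.iInter fun a => .iInter fun b => .iInter fun _ =>
      measurableSet_le (measurable_pi_apply _) (measurable_pi_apply _))
      (.iInter fun i => .iInter fun j => .iInter fun _ => ?_)
    by_cases h : π i < π j
    · simp [h]
    · simp only [h, imp_false]
      exact (measurableSet_eq_fun (f := fun u : Fin N → I => u (π i)) (measurable_pi_apply _)
        (measurable_pi_apply (π j))).compl
  intro B hB
  have : orderStat ⁻¹' B = ⋃ π : Equiv.Perm (Fin N),
      {u : Fin N → I | π = Tuple.sort u} ∩ (fun u => u ∘ π) ⁻¹' B := by
    ext u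
    simp [orderStat]
  rw [this]
  exact .iUnion fun π => (hsort π).inter
    ((measurable_pi_lambda _ fun i => measurable_pi_apply (π i)) hB)

/-! ### Sub-Gaussian tails -/

namespace IsSampledGraph

variable {Ω : Type*} [MeasurableSpace Ω] {P : Measure Ω} {W : Graphon} {N : ℕ}
  {U : Fin N → Ω → I} {G : Ω → SimpleGraph (Fin N)}

theorem measurable_orderStat_latent (hG : IsSampledGraph P W N U G) :
    Measurable fun ω => orderStat fun i => U i ω :=
  measurable_orderStat.comp (measurable_pi_lambda _ hG.measurable_latent)

open Classical in
/-- The edge probabilities `W (X i) (X j)` are measurable with respect to the latent variables, up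
to null sets. `W` is only Lebesgue measurable, so this is read off from the conditional law of the
graph, whose marginals they are, rather than from the law of `(X i, X j)`. -/
theorem aestronglyMeasurable_edgeProb (hG : IsSampledGraph P W N U G) {q : Fin N × Fin N}
    (hq : q ∈ vertexPairs N) :
    AEStronglyMeasurable[MeasurableSpace.comap (fun ω => orderStat fun i => U i ω) inferInstance]
      (fun ω => W (orderStat (fun i => U i ω) q.1) (orderStat (fun i => U i ω) q.2)) P := by
  refine ⟨fun ω => ∑ H : SimpleGraph (Fin N), if H.Adj q.1 q.2 then
    (P[Set.indicator {ω | G ω = H} (fun _ => (1 : ℝ)) |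
      MeasurableSpace.comap (fun ω => orderStat (fun i => U i ω)) inferInstance]) ω else 0, ?_, ?_⟩
  · refine Finset.stronglyMeasurable_fun_sum _ fun H _ => ?_
    split_ifs
    · exact stronglyMeasurable_condExp
    · exact stronglyMeasurable_const
  · filter_upwards [ae_all_iff.2 hG.condProb_graph] with ω hω
    simp only [hω]
    exact (W.sum_graphProb_adj _ hq).symm

variable [IsProbabilityMeasure P]

/-- Averaging over the edges first: the indicator of `G = H` may be replaced by the conditional
probability of `H` against functions of the latent variables. -/
theorem integral_indicator_mul (hG : IsSampledGraph P W N U G) (H : SimpleGraph (Fin N))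
    {f : Ω → ℝ} {C : ℝ} (hC : ∀ ω, |f ω| ≤ C)
    (hf : AEStronglyMeasurable[MeasurableSpace.comap (fun ω => orderStat fun i => U i ω)
      inferInstance] f P) :
    Integrable (fun ω => f ω * W.graphProb (orderStat fun i => U i ω) H) P ∧
    ∫ ω, f ω * Set.indicator {ω | G ω = H} (fun _ => (1 : ℝ)) ω ∂P =
      ∫ ω, f ω * W.graphProb (orderStat fun i => U i ω) H ∂P := by
  have hm := hG.measurable_orderStat_latent.comap_le
  have hind : Integrable (Set.indicator {ω | G ω = H} fun _ => (1 : ℝ)) P :=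
    (integrable_const _).indicator (hG.measurableSet_graph H)
  have hmul : Integrable (f * Set.indicator {ω | G ω = H} fun _ => (1 : ℝ)) P :=
    hind.bdd_mul (hf.mono hm) (ae_of_all _ hC)
  have hpull := (condExp_mul_of_aestronglyMeasurable_left hf hmul hind).trans
    (EventuallyEq.rfl.mul (hG.condProb_graph H))
  exact ⟨integrable_condExp.congr hpull,
    (integral_condExp hm).symm.trans (integral_congr_ae hpull)⟩

open Classical in
/-- Conditionally on the latent variables, `edgeDeviation` is a sum of independent centred
bounded variables, hence sub-Gaussian. -/
theorem integral_exp_edgeDeviation_le (hG : IsSampledGraph P W N U G) (c : Fin N × Fin N → ℝ) :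
    Integrable (fun ω => Real.exp (W.edgeDeviation (orderStat fun i => U i ω) (G ω) c)) P ∧
    ∫ ω, Real.exp (W.edgeDeviation (orderStat fun i => U i ω) (G ω) c) ∂P ≤
      Real.exp (∑ p ∈ vertexPairs N, c p ^ 2) := by
  have hm := hG.measurable_orderStat_latent.comap_le
  set f : SimpleGraph (Fin N) → Ω → ℝ := fun H ω =>
    Real.exp (W.edgeDeviation (orderStat fun i => U i ω) H c) with hf_def
  have hbd : ∀ H ω, |f H ω| ≤ Real.exp (∑ p ∈ vertexPairs N, |c p|) := fun H ω => by
    rw [hf_def, Real.abs_exp]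
    exact Real.exp_le_exp.2 ((le_abs_self _).trans (W.abs_edgeDeviation_le _ _ _))
  have hmeas : ∀ H, AEStronglyMeasurable[MeasurableSpace.comap
      (fun ω => orderStat fun i => U i ω) inferInstance] (f H) P := fun H => by
    refine Real.continuous_exp.comp_aestronglyMeasurable ?_
    have hterm : ∀ p ∈ vertexPairs N, AEStronglyMeasurable[MeasurableSpace.comap
        (fun ω => orderStat fun i => U i ω) inferInstance] (fun ω => c p *
          ((if H.Adj p.1 p.2 then 1 else 0) -
            W (orderStat (fun i => U i ω) p.1) (orderStat (fun i => U i ω) p.2))) P := fun p hp =>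
      aestronglyMeasurable_const.mul
        (aestronglyMeasurable_const.sub (hG.aestronglyMeasurable_edgeProb hp))
    have hsum := Finset.sum_induction _ (fun g : Ω → ℝ => AEStronglyMeasurable[MeasurableSpace.comap
      (fun ω => orderStat fun i => U i ω) inferInstance] g P) (fun _ _ h₁ h₂ => h₁.add h₂)
      aestronglyMeasurable_const hterm
    simpa only [Finset.sum_fn, Graphon.edgeDeviation] using hsum
  have hsplit : ∀ ω, Real.exp (W.edgeDeviation (orderStat fun i => U i ω) (G ω) c) =
      ∑ H, f H ω * Set.indicator {ω | G ω = H} (fun _ => (1 : ℝ)) ω := fun ω => by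
    rw [Finset.sum_eq_single (G ω) (fun H _ hH => by simp [Set.indicator, hH.symm]) (by simp)]
    simp [hf_def]
  have hint : ∀ H, Integrable
      (fun ω => f H ω * Set.indicator {ω | G ω = H} (fun _ => (1 : ℝ)) ω) P := fun H =>
    ((integrable_const _).indicator (hG.measurableSet_graph H)).bdd_mul ((hmeas H).mono hm)
      (ae_of_all _ (hbd H))
  simp_rw [hsplit]
  refine ⟨integrable_finsetSum _ fun H _ => hint H, ?_⟩
  rw [integral_finsetSum _ fun H _ => hint H]
  simp_rw [fun H => (hG.integral_indicator_mul H (hbd H) (hmeas H)).2]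
  have hint' := fun H => (hG.integral_indicator_mul H (hbd H) (hmeas H)).1
  rw [← integral_finsetSum _ fun H _ => hint' H]
  calc ∫ ω, ∑ H, f H ω * W.graphProb (orderStat fun i => U i ω) H ∂P
      ≤ ∫ _, Real.exp (∑ p ∈ vertexPairs N, c p ^ 2) ∂P := by
        refine integral_mono (integrable_finsetSum _ fun H _ => hint' H) (integrable_const _)
          fun ω => ?_
        simp only [mul_comm (f _ ω)]
        exact W.sum_graphProb_mul_exp_edgeDeviation_le _ c
    _ = Real.exp (∑ p ∈ vertexPairs N, c p ^ 2) := by simp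

theorem measureReal_le_edgeDeviation_le (hG : IsSampledGraph P W N U G) (c : Fin N × Fin N → ℝ)
    {V t : ℝ} (hV : 0 < V) (hc : ∑ p ∈ vertexPairs N, c p ^ 2 ≤ V) (ht : 0 ≤ t) :
    P.real {ω | t ≤ W.edgeDeviation (orderStat fun i => U i ω) (G ω) c} ≤
      Real.exp (-(t ^ 2 / (4 * V))) := by
  -- the Chernoff exponent `-s * t + s ^ 2 * V` is minimal at this value of `s`
  set s := t / (2 * V) with hs
  have hlin : ∀ ω, s * W.edgeDeviation (orderStat fun i => U i ω) (G ω) c =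
      W.edgeDeviation (orderStat fun i => U i ω) (G ω) (fun p => s * c p) := fun ω => by
    simp only [Graphon.edgeDeviation, Finset.mul_sum, mul_assoc]
  obtain ⟨hint, hle⟩ := hG.integral_exp_edgeDeviation_le fun p => s * c p
  refine (measure_ge_le_exp_mul_mgf t (by positivity : 0 ≤ s) (by simpa only [hlin])).trans ?_
  have hmgf : mgf (fun ω => W.edgeDeviation (orderStat fun i => U i ω) (G ω) c) P s ≤
      Real.exp (s ^ 2 * V) := by
    simp only [mgf, hlin]
    refine hle.trans (Real.exp_le_exp.2 ?_)
    simp only [mul_pow, ← Finset.mul_sum]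
    exact mul_le_mul_of_nonneg_left hc (sq_nonneg s)
  refine (mul_le_mul_of_nonneg_left hmgf (Real.exp_nonneg _)).trans_eq ?_
  rw [← Real.exp_add, hs]
  congr 1
  field_simp
  ring

theorem measureReal_le_abs_edgeDeviation_le (hG : IsSampledGraph P W N U G)
    (c : Fin N × Fin N → ℝ) {V t : ℝ} (hV : 0 < V) (hc : ∑ p ∈ vertexPairs N, c p ^ 2 ≤ V)
    (ht : 0 ≤ t) :
    P.real {ω | t ≤ |W.edgeDeviation (orderStat fun i => U i ω) (G ω) c|} ≤
      2 * Real.exp (-(t ^ 2 / (4 * V))) := by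
  have hneg : ∀ ω, W.edgeDeviation (orderStat fun i => U i ω) (G ω) (fun p => -c p) =
      -W.edgeDeviation (orderStat fun i => U i ω) (G ω) c := fun ω => by
    simp [Graphon.edgeDeviation]
  have h1 := hG.measureReal_le_edgeDeviation_le c hV hc ht
  have h2 := hG.measureReal_le_edgeDeviation_le (fun p => -c p) hV (by simpa using hc) ht
  simp only [hneg] at h2
  simp only [le_abs, Set.ofPred_or]
  exact (measureReal_union_le _ _).trans (by linarith)

end IsSampledGraph

/-! ### Quadratic forms of Laplacians and a lattice net -/

theorem sum_eq_sum_vertexPairs {N : ℕ} {f : Fin N → Fin N → ℝ} (hf : ∀ i, f i i = 0) :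
    ∑ i, ∑ j, f i j = ∑ p ∈ vertexPairs N, (f p.1 p.2 + f p.2 p.1) := by
  have h1 : ∑ p ∈ vertexPairs N, f p.2 p.1 = ∑ p : Fin N × Fin N with p.2 < p.1, f p.1 p.2 :=
    Finset.sum_nbij' Prod.swap Prod.swap (by simp [vertexPairs]) (by simp [vertexPairs])
      (by simp) (by simp) (by simp)
  rw [Finset.sum_add_distrib, h1, vertexPairs, Finset.sum_filter, Finset.sum_filter,
    ← Finset.sum_add_distrib, Fintype.sum_prod_type]
  refine Finset.sum_congr rfl fun i _ => Finset.sum_congr rfl fun j _ => ?_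
  rcases lt_trichotomy i j with h | h | h
  · simp [h, h.not_gt]
  · simp [h, hf]
  · simp [h, h.not_gt]

theorem dotProduct_weightedLaplacian_mulVec {N : ℕ} {A : Matrix (Fin N) (Fin N) ℝ}
    (hA : A.IsSymm) (v : Fin N → ℝ) :
    dotProduct v ((weightedLaplacian A).mulVec v) =
      ∑ p ∈ vertexPairs N, A p.1 p.2 * (v p.1 - v p.2) ^ 2 := by
  have h : dotProduct v ((weightedLaplacian A).mulVec v) =
      ∑ i, ∑ j, A i j * (v i * (v i - v j)) := by
    rw [weightedLaplacian, Matrix.sub_mulVec]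
    simp only [dotProduct, Pi.sub_apply, Matrix.mulVec_diagonal]
    simp only [Matrix.mulVec, dotProduct, Finset.sum_mul, ← Finset.sum_sub_distrib, Finset.mul_sum]
    exact Finset.sum_congr rfl fun i _ => Finset.sum_congr rfl fun j _ => by ring
  rw [h, sum_eq_sum_vertexPairs (fun i => by ring)]
  refine Finset.sum_congr rfl fun p _ => ?_
  rw [hA.apply p.1 p.2]
  ring

/-- The coefficients of the statistic that is the centred degree of the vertex `k`. -/
def degreeCoeff {N : ℕ} (k : Fin N) (p : Fin N × Fin N) : ℝ :=
  (if p.1 = k then 1 else 0) + if p.2 = k then 1 else 0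

/-- The coefficients of the statistic that is the quadratic form of the centred adjacency matrix
at `u`. -/
def adjCoeff {N : ℕ} (u : Fin N → ℝ) (p : Fin N × Fin N) : ℝ := 2 * (u p.1 * u p.2)

theorem sum_degreeCoeff_sq_le {N : ℕ} (k : Fin N) :
    ∑ p ∈ vertexPairs N, degreeCoeff k p ^ 2 ≤ 4 * N := by
  calc ∑ p ∈ vertexPairs N, degreeCoeff k p ^ 2
      ≤ ∑ p : Fin N × Fin N, degreeCoeff k p ^ 2 :=
        Finset.sum_le_sum_of_subset_of_nonneg (Finset.subset_univ _) fun _ _ _ => sq_nonneg _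
    _ ≤ ∑ p : Fin N × Fin N, 2 * degreeCoeff k p := Finset.sum_le_sum fun p _ => by
        unfold degreeCoeff; split_ifs <;> norm_num
    _ = 4 * N := by
        have hconst : ∀ i : Fin N, (∑ _j : Fin N, if i = k then (1 : ℝ) else 0) =
            if i = k then (N : ℝ) else 0 := fun i => by split_ifs <;> simp
        simp only [degreeCoeff, Fintype.sum_prod_type, ← Finset.mul_sum, Finset.sum_add_distrib,
          hconst]
        simp
        ring

theorem sum_adjCoeff_sq_le {N : ℕ} {u : Fin N → ℝ} (hu : ∑ i, u i ^ 2 ≤ 4) :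
    ∑ p ∈ vertexPairs N, adjCoeff u p ^ 2 ≤ 64 := by
  calc ∑ p ∈ vertexPairs N, adjCoeff u p ^ 2
      ≤ ∑ p : Fin N × Fin N, adjCoeff u p ^ 2 :=
        Finset.sum_le_sum_of_subset_of_nonneg (Finset.subset_univ _) fun _ _ _ => sq_nonneg _
    _ = 4 * (∑ i, u i ^ 2) ^ 2 := by
        rw [sq (∑ i, u i ^ 2), Finset.sum_mul_sum, Fintype.sum_prod_type]
        simp only [adjCoeff, Finset.mul_sum]
        refine Finset.sum_congr rfl fun i _ => Finset.sum_congr rfl fun j _ => by ring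
    _ ≤ 64 := by nlinarith [Finset.sum_nonneg fun i (_ : i ∈ Finset.univ) => sq_nonneg (u i)]

/-- A net for the unit sphere of `ℝ^N`: the integer vectors `z` whose points `z / N ^ 2` have
coordinates in `[-1, 1]` and squared norm at most `4`. Rounding down may leave the unit ball, so
the norm is allowed some room. -/
noncomputable def latticeNet (N : ℕ) : Finset (Fin N → ℤ) :=
  {z ∈ Fintype.piFinset fun _ : Fin N => Finset.Icc (-(N : ℤ) ^ 2) ((N : ℤ) ^ 2) |
    ∑ i, (z i) ^ 2 ≤ 4 * (N : ℤ) ^ 4}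

/-- The point of `ℝ^N` represented by the integer vector `z`. -/
noncomputable def latticePoint {N : ℕ} (z : Fin N → ℤ) (i : Fin N) : ℝ := z i / (N : ℝ) ^ 2

theorem card_latticeNet_le (N : ℕ) : (latticeNet N).card ≤ (2 * N ^ 2 + 1) ^ N := by
  refine (Finset.card_filter_le _ _).trans ?_
  rw [Fintype.card_piFinset]
  simp only [Int.card_Icc, Finset.prod_const, Finset.card_univ, Fintype.card_fin]
  refine Nat.pow_le_pow_left ?_ N
  zify
  rw [Int.toNat_of_nonneg (by linarith [sq_nonneg (N : ℤ)])]
  linarith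

theorem sum_latticePoint_sq_le {N : ℕ} {z : Fin N → ℤ} (hz : z ∈ latticeNet N) :
    ∑ i, latticePoint z i ^ 2 ≤ 4 := by
  have h : (∑ i, (z i : ℝ) ^ 2) ≤ 4 * (N : ℝ) ^ 4 := by
    exact_mod_cast (Finset.mem_filter.1 hz).2
  simp only [latticePoint, div_pow, ← Finset.sum_div, ← pow_mul]
  exact div_le_of_le_mul₀ (by positivity) (by norm_num) h

theorem exists_mem_latticeNet {N : ℕ} (hN : 0 < N) {v : Fin N → ℝ} (hv : ∑ i, v i ^ 2 = 1) :
    ∃ z ∈ latticeNet N, ∀ i, |latticePoint z i| ≤ 1 ∧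
      |v i - latticePoint z i| ≤ 1 / (N : ℝ) ^ 2 := by
  have hN' : (1 : ℝ) ≤ N := by exact_mod_cast hN
  have hM : (0 : ℝ) < (N : ℝ) ^ 2 := by positivity
  have hv1 : ∀ i, -1 ≤ v i ∧ v i ≤ 1 := fun i => by
    have h := Finset.single_le_sum (fun i _ => sq_nonneg (v i)) (Finset.mem_univ i)
    rw [hv] at h
    exact abs_le.1 ((sq_le_one_iff_abs_le_one _).1 h)
  set z : Fin N → ℤ := fun i => ⌊v i * (N : ℝ) ^ 2⌋ with hz
  have hlo : ∀ i, -(N : ℤ) ^ 2 ≤ z i := fun i => Int.le_floor.2 (by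
    push_cast; nlinarith [(hv1 i).1])
  have hhi : ∀ i, z i ≤ (N : ℤ) ^ 2 := fun i => by
    have : (z i : ℝ) ≤ (N : ℝ) ^ 2 := (Int.floor_le _).trans (by nlinarith [(hv1 i).2])
    exact_mod_cast this
  have hlt : ∀ i, v i * (N : ℝ) ^ 2 - 1 < z i := fun i => Int.sub_one_lt_floor _
  have hle : ∀ i, (z i : ℝ) ≤ v i * (N : ℝ) ^ 2 := fun i => Int.floor_le _
  refine ⟨z, ?_, fun i => ⟨?_, ?_⟩⟩
  · simp only [latticeNet, Finset.mem_filter, Fintype.mem_piFinset, Finset.mem_Icc]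
    refine ⟨fun i => ⟨hlo i, hhi i⟩, ?_⟩
    have hsum : ∑ i, (z i : ℝ) ^ 2 ≤ 4 * (N : ℝ) ^ 4 := by
      calc ∑ i, (z i : ℝ) ^ 2 ≤ ∑ i, (2 * (N : ℝ) ^ 4 * v i ^ 2 + 2) :=
            Finset.sum_le_sum fun i _ => by
              nlinarith [hlt i, hle i, sq_nonneg ((z i : ℝ) - 2 * (v i * (N : ℝ) ^ 2))]
        _ = 2 * (N : ℝ) ^ 4 + 2 * N := by
            rw [Finset.sum_add_distrib, ← Finset.mul_sum, hv]
            simp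
            ring
        _ ≤ 4 * (N : ℝ) ^ 4 := by
            linarith [le_self_pow₀ hN' (by norm_num : 4 ≠ 0)]
    exact_mod_cast hsum
  · rw [latticePoint, abs_div, abs_of_pos hM, div_le_one hM, abs_le]
    exact ⟨by exact_mod_cast hlo i, by exact_mod_cast hhi i⟩
  · have : v i - latticePoint z i = (v i * (N : ℝ) ^ 2 - z i) / (N : ℝ) ^ 2 := by
      rw [latticePoint]
      field_simp
    rw [this, abs_div, abs_of_pos hM]
    gcongr
    rw [abs_le]
    constructor <;> linarith [hlt i, hle i]

namespace Graphon

variable (W : Graphon) {N : ℕ} (x : Fin N → I) (H : SimpleGraph (Fin N))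

theorem edgeDeviation_sub (c d : Fin N × Fin N → ℝ) :
    W.edgeDeviation x H (fun p => c p - d p) = W.edgeDeviation x H c - W.edgeDeviation x H d := by
  simp only [edgeDeviation, sub_mul, Finset.sum_sub_distrib]

open Classical in
theorem dotProduct_laplacian_sub (v : Fin N → ℝ) :
    dotProduct v ((weightedLaplacian (H.adjMatrix ℝ)).mulVec v) -
        dotProduct v ((weightedLaplacian (W.weightedAdj x)).mulVec v) =
      ∑ k, v k ^ 2 * W.edgeDeviation x H (degreeCoeff k) -
        W.edgeDeviation x H (adjCoeff v) := by
  have hdeg : ∑ k, v k ^ 2 * W.edgeDeviation x H (degreeCoeff k) =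
      W.edgeDeviation x H fun p => v p.1 ^ 2 + v p.2 ^ 2 := by
    simp only [edgeDeviation, Finset.mul_sum]
    rw [Finset.sum_comm]
    refine Finset.sum_congr rfl fun p _ => ?_
    simp only [degreeCoeff, ← mul_assoc, ← Finset.sum_mul]
    simp [mul_add, Finset.sum_add_distrib]
  rw [hdeg, ← edgeDeviation_sub, dotProduct_weightedLaplacian_mulVec H.isSymm_adjMatrix,
    dotProduct_weightedLaplacian_mulVec (W.weightedAdj_isSymm x), ← Finset.sum_sub_distrib]
  refine Finset.sum_congr rfl fun p _ => ?_
  simp only [SimpleGraph.adjMatrix_apply, weightedAdj, Matrix.of_apply, adjCoeff]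
  ring

/-- Deviations that are controlled on the net are controlled on the whole unit sphere, because the
mesh `1 / N ^ 2` makes up for the `N ^ 2` terms of the quadratic form. -/
theorem abs_edgeDeviation_adjCoeff_le (hN : 0 < N) {t : ℝ}
    (h : ∀ z ∈ latticeNet N, |W.edgeDeviation x H (adjCoeff (latticePoint z))| ≤ t)
    {v : Fin N → ℝ} (hv : ∑ i, v i ^ 2 = 1) :
    |W.edgeDeviation x H (adjCoeff v)| ≤ t + 4 := by
  obtain ⟨z, hz, hzv⟩ := exists_mem_latticeNet hN hv
  have hN' : (0 : ℝ) < N := by exact_mod_cast hN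
  have hv1 : ∀ i, |v i| ≤ 1 := fun i => by
    have h := Finset.single_le_sum (fun i _ => sq_nonneg (v i)) (Finset.mem_univ i)
    rw [hv] at h
    exact (sq_le_one_iff_abs_le_one _).1 h
  have hround : |W.edgeDeviation x H fun p => adjCoeff v p - adjCoeff (latticePoint z) p| ≤ 4 := by
    calc _ ≤ ∑ p ∈ vertexPairs N, |adjCoeff v p - adjCoeff (latticePoint z) p| :=
          W.abs_edgeDeviation_le x H _
      _ ≤ ∑ p ∈ vertexPairs N, 4 / (N : ℝ) ^ 2 := Finset.sum_le_sum fun p _ => by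
          have e : adjCoeff v p - adjCoeff (latticePoint z) p =
              2 * (v p.1 * (v p.2 - latticePoint z p.2) +
                (v p.1 - latticePoint z p.1) * latticePoint z p.2) := by
            unfold adjCoeff; ring
          rw [e, abs_mul, abs_of_pos (by norm_num : (0 : ℝ) < 2)]
          have h1 : |v p.1 * (v p.2 - latticePoint z p.2)| ≤ 1 * (1 / (N : ℝ) ^ 2) := by
            rw [abs_mul]
            exact mul_le_mul (hv1 _) (hzv _).2 (abs_nonneg _) zero_le_one
          have h2 : |(v p.1 - latticePoint z p.1) * latticePoint z p.2| ≤
              1 / (N : ℝ) ^ 2 * 1 := by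
            rw [abs_mul]
            exact mul_le_mul (hzv _).2 (hzv _).1 (abs_nonneg _) (by positivity)
          have h3 := abs_add_le (v p.1 * (v p.2 - latticePoint z p.2))
            ((v p.1 - latticePoint z p.1) * latticePoint z p.2)
          have h4 : 4 / (N : ℝ) ^ 2 = 4 * (1 / (N : ℝ) ^ 2) := by ring
          linarith
      _ ≤ ∑ p : Fin N × Fin N, 4 / (N : ℝ) ^ 2 :=
          Finset.sum_le_sum_of_subset_of_nonneg (Finset.subset_univ _)
            fun _ _ _ => by positivity
      _ = 4 := by
          simp
          field_simp
  rw [edgeDeviation_sub] at hround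
  have := h z hz
  rw [abs_le] at *
  constructor <;> linarith

/-- If the centred degrees and the adjacency form on the net are at most `t`, the normalized
eigenvalues differ by at most `(2 t + 4) / N`. -/
theorem abs_graphEigenvalue_sub_weightedEigenvalue_le (hN : 0 < N) {t : ℝ}
    (hnet : ∀ z ∈ latticeNet N, |W.edgeDeviation x H (adjCoeff (latticePoint z))| ≤ t)
    (hdeg : ∀ k, |W.edgeDeviation x H (degreeCoeff k)| ≤ t) (i : Fin N) :
    |graphEigenvalue H i - W.weightedEigenvalue x i| ≤ (2 * t + 4) / N := by
  classical
  rw [graphEigenvalue, weightedEigenvalue, normalizedEigenvalue, normalizedEigenvalue, ← sub_div,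
    abs_div, Nat.abs_cast]
  gcongr
  refine Matrix.IsHermitian.abs_eigenvalues₀_sub_le _ _ (fun v hv => ?_) _
  rw [dotProduct_laplacian_sub]
  have h1 : |∑ k, v k ^ 2 * W.edgeDeviation x H (degreeCoeff k)| ≤ t := by
    refine (Finset.abs_sum_le_sum_abs _ _).trans ?_
    calc ∑ k, |v k ^ 2 * W.edgeDeviation x H (degreeCoeff k)| ≤ ∑ k, v k ^ 2 * t :=
          Finset.sum_le_sum fun k _ => by
            rw [abs_mul, abs_sq]
            exact mul_le_mul_of_nonneg_left (hdeg k) (sq_nonneg _)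
      _ = t := by rw [← Finset.sum_mul, hv, one_mul]
  have h2 := W.abs_edgeDeviation_adjCoeff_le x H hN hnet hv
  rw [abs_le] at *
  constructor <;> linarith

end Graphon

/-! ### Union bound and Borel–Cantelli -/

/-- The event that some centred degree, or the quadratic form of the centred adjacency matrix at
some point of the net, is at least `40 √(N log N)` in absolute value. Declared empty for `N < 2`. -/
def largeDeviationEvent {Ω : Type*} (W : Graphon) (N : ℕ) (U : Fin N → Ω → I)
    (G : Ω → SimpleGraph (Fin N)) : Set Ω :=
  {ω | 2 ≤ N ∧
    ((∃ z ∈ latticeNet N, 40 * √(N * Real.log N) ≤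
      |W.edgeDeviation (orderStat fun i => U i ω) (G ω) (adjCoeff (latticePoint z))|) ∨
    ∃ k, 40 * √(N * Real.log N) ≤
      |W.edgeDeviation (orderStat fun i => U i ω) (G ω) (degreeCoeff k)|)}

/-- The tail exponent `25 / 4 * N log N` outweighs the size of the net, since
`2 N ^ 2 + 1 ≤ N ^ 4`. -/
theorem latticeNet_card_bound_mul_exp_le {N : ℕ} (hN : 2 ≤ N) :
    (((2 * N ^ 2 + 1) ^ N : ℕ) : ℝ) * Real.exp (-(25 / 4 * (N * Real.log N))) ≤
      1 / (N : ℝ) ^ 2 := by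
  have hN' : (2 : ℝ) ≤ N := by exact_mod_cast hN
  have hpos : (0 : ℝ) < N := by linarith
  have hlog : 0 ≤ Real.log N := Real.log_nonneg (by linarith)
  have hpow : ∀ k : ℕ, (N : ℝ) ^ k = Real.exp (k * Real.log N) := fun k => by
    rw [← Real.log_pow, Real.exp_log (by positivity)]
  have hbase : (2 * (N : ℝ) ^ 2 + 1) ^ N ≤ (N : ℝ) ^ (4 * N) := by
    rw [pow_mul]
    refine pow_le_pow_left₀ (by positivity) ?_ N
    nlinarith [sq_nonneg ((N : ℝ) ^ 2), mul_self_le_mul_self (by norm_num) hN']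
  push_cast
  refine (mul_le_mul_of_nonneg_right hbase (Real.exp_nonneg _)).trans ?_
  rw [hpow, hpow, one_div, ← Real.exp_neg, ← Real.exp_add, Real.exp_le_exp]
  push_cast
  nlinarith [mul_le_mul_of_nonneg_right hN' hlog]

namespace IsSampledGraph

variable {Ω : Type*} [MeasurableSpace Ω] {P : Measure Ω} [IsProbabilityMeasure P] {W : Graphon}
  {N : ℕ} {U : Fin N → Ω → I} {G : Ω → SimpleGraph (Fin N)}

theorem measureReal_largeDeviationEvent_le (hG : IsSampledGraph P W N U G) :
    P.real (largeDeviationEvent W N U G) ≤ 4 / (N : ℝ) ^ 2 := by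
  rcases lt_or_ge N 2 with hN | hN
  · have : largeDeviationEvent W N U G = ∅ := by
      ext ω
      simp [largeDeviationEvent, hN.not_ge]
    rw [this, measureReal_empty]
    positivity
  have hN' : (2 : ℝ) ≤ N := by exact_mod_cast hN
  have hpos : (0 : ℝ) < N := by linarith
  have hlog : 0 ≤ Real.log N := Real.log_nonneg (by linarith)
  set t := 40 * √(N * Real.log N) with ht
  have ht0 : 0 ≤ t := by positivity
  have ht2 : t ^ 2 = 1600 * (N * Real.log N) := by
    rw [ht, mul_pow, Real.sq_sqrt (by positivity)]
    norm_num
  have hsub : largeDeviationEvent W N U G ⊆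
      (⋃ z ∈ latticeNet N, {ω | t ≤
        |W.edgeDeviation (orderStat fun i => U i ω) (G ω) (adjCoeff (latticePoint z))|}) ∪
      ⋃ k, {ω | t ≤ |W.edgeDeviation (orderStat fun i => U i ω) (G ω) (degreeCoeff k)|} := by
    rintro ω ⟨-, ⟨z, hz, h⟩ | ⟨k, h⟩⟩
    · exact .inl (Set.mem_biUnion hz h)
    · exact .inr (Set.mem_iUnion.2 ⟨k, h⟩)
  have hnet : P.real (⋃ z ∈ latticeNet N, {ω | t ≤
      |W.edgeDeviation (orderStat fun i => U i ω) (G ω) (adjCoeff (latticePoint z))|}) ≤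
      2 / (N : ℝ) ^ 2 := by
    -- `25 / 4 = 40 ^ 2 / (4 * 64)`
    calc _ ≤ ∑ z ∈ latticeNet N, P.real {ω | t ≤
          |W.edgeDeviation (orderStat fun i => U i ω) (G ω) (adjCoeff (latticePoint z))|} :=
          measureReal_biUnion_finset_le _ _
      _ ≤ ∑ z ∈ latticeNet N, 2 * Real.exp (-(t ^ 2 / (4 * 64))) :=
          Finset.sum_le_sum fun z hz => hG.measureReal_le_abs_edgeDeviation_le _ (by norm_num)
            (sum_adjCoeff_sq_le (sum_latticePoint_sq_le hz)) ht0
      _ = 2 * ((latticeNet N).card * Real.exp (-(25 / 4 * (N * Real.log N)))) := by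
          rw [Finset.sum_const, nsmul_eq_mul, ht2]
          ring_nf
      _ ≤ 2 * ((((2 * N ^ 2 + 1) ^ N : ℕ) : ℝ) * Real.exp (-(25 / 4 * (N * Real.log N)))) := by
          gcongr
          exact card_latticeNet_le N
      _ ≤ 2 * (1 / (N : ℝ) ^ 2) := by gcongr; exact latticeNet_card_bound_mul_exp_le hN
      _ = 2 / (N : ℝ) ^ 2 := by ring
  have hdeg : P.real (⋃ k, {ω | t ≤
      |W.edgeDeviation (orderStat fun i => U i ω) (G ω) (degreeCoeff k)|}) ≤
      2 / (N : ℝ) ^ 2 := by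
    calc _ ≤ ∑ k, P.real {ω | t ≤
          |W.edgeDeviation (orderStat fun i => U i ω) (G ω) (degreeCoeff k)|} :=
          measureReal_iUnion_fintype_le _
      _ ≤ ∑ k : Fin N, 2 * Real.exp (-(t ^ 2 / (4 * (4 * N)))) :=
          Finset.sum_le_sum fun k _ => hG.measureReal_le_abs_edgeDeviation_le _ (by positivity)
            (sum_degreeCoeff_sq_le k) ht0
      _ = 2 * (N * Real.exp (-(100 * Real.log N))) := by
          rw [Finset.sum_const, nsmul_eq_mul, ht2, Finset.card_univ, Fintype.card_fin]
          have : 1600 * (N * Real.log N) / (4 * (4 * (N : ℝ))) = 100 * Real.log N := by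
            field_simp
            ring
          rw [this]
          ring
      _ ≤ 2 * (N * Real.exp (-(3 * Real.log N))) := by
          gcongr
          norm_num
      _ = 2 / (N : ℝ) ^ 2 := by
          have : Real.exp (3 * Real.log N) = (N : ℝ) ^ 3 := by
            rw [← Real.exp_log (by positivity : (0 : ℝ) < (N : ℝ) ^ 3), Real.log_pow]
            norm_num
          rw [Real.exp_neg, this]
          field_simp
  calc _ ≤ _ := measureReal_mono hsub
    _ ≤ _ := measureReal_union_le _ _
    _ ≤ 2 / (N : ℝ) ^ 2 + 2 / (N : ℝ) ^ 2 := add_le_add hnet hdeg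
    _ = 4 / (N : ℝ) ^ 2 := by ring

end IsSampledGraph

/-- Borel–Cantelli: the tail bounds are summable, so no relation between the samples for
different `N` is needed. -/
theorem ae_eventually_abs_eigenvalue_sub_le {Ω : Type*} [MeasurableSpace Ω] (P : Measure Ω)
    [IsProbabilityMeasure P] (W : Graphon) (U : (N : ℕ) → Fin N → Ω → I)
    (G : (N : ℕ) → Ω → SimpleGraph (Fin N)) (hG : ∀ N, IsSampledGraph P W N (U N) (G N)) :
    ∀ᵐ ω ∂P, ∀ᶠ N : ℕ in atTop, ∀ i : Fin N,
      |graphEigenvalue (G N ω) i - W.weightedEigenvalue (orderStat (fun j => U N j ω)) i| ≤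
        84 * √(Real.log N / N) := by
  have hsum : ∑' N, P (largeDeviationEvent W N (U N) (G N)) ≠ ⊤ := by
    have hs : Summable fun N : ℕ => 4 / (N : ℝ) ^ 2 := by
      simpa [div_eq_mul_inv] using (Real.summable_nat_pow_inv.2 one_lt_two).mul_left 4
    refine ne_top_of_le_ne_top hs.tsum_ofReal_ne_top (ENNReal.tsum_le_tsum fun N => ?_)
    rw [← ofReal_measureReal]
    exact ENNReal.ofReal_le_ofReal (hG N).measureReal_largeDeviationEvent_le
  filter_upwards [ae_eventually_notMem hsum] with ω hω
  filter_upwards [hω, eventually_ge_atTop 3] with N hN h3 i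
  simp only [largeDeviationEvent, Set.mem_ofPred_eq, not_and, not_or, not_exists, not_le] at hN
  obtain ⟨hnet, hdeg⟩ := hN (by omega)
  have h3' : (3 : ℝ) ≤ N := by exact_mod_cast h3
  have hpos : (0 : ℝ) < N := by linarith
  have hlog : 1 ≤ Real.log N := by
    rw [Real.le_log_iff_exp_le hpos]
    linarith [Real.exp_one_lt_d9]
  refine (W.abs_graphEigenvalue_sub_weightedEigenvalue_le _ _ (by omega)
    (fun z hz => (hnet z hz).le) (fun k => (hdeg k).le) i).trans ?_
  have h1 : √(N * Real.log N) = N * √(Real.log N / N) := by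
    rw [Real.sqrt_eq_iff_mul_self_eq (by positivity) (by positivity)]
    have := Real.mul_self_sqrt (by positivity : 0 ≤ Real.log N / N)
    rw [mul_mul_mul_comm, this]
    field_simp
  have h2 : 1 ≤ N * √(Real.log N / N) := by
    rw [← h1, Real.one_le_sqrt]
    nlinarith
  -- `84 = 2 * 40 + 4`
  rw [div_le_iff₀ hpos, h1]
  linarith

theorem mainTheorem2 {Ω : Type*} [MeasurableSpace Ω] (P : Measure Ω) [IsProbabilityMeasure P]
    (W : Graphon) (hW : W.HasPosInf ∨ W.PiecewiseLipschitz ∨ W.IsContinuous)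
    (U : (N : ℕ) → Fin N → Ω → I) (G : (N : ℕ) → Ω → SimpleGraph (Fin N))
    (hG : ∀ N, IsSampledGraph P W N (U N) (G N)) :
    (∀ᵐ ω ∂P,
      (fun N : ℕ => ⨆ i : Fin N,
        |graphEigenvalue (G N ω) i - W.weightedEigenvalue (orderStat (fun j => U N j ω)) i|)
      =O[atTop] fun N : ℕ => √(Real.log N / N)) ∧
    (∀ᵐ ω ∂P,
      (fun N : ℕ => if h : 2 ≤ N then
        |graphEigenvalue (G N ω) ⟨1, h⟩ -
          W.weightedEigenvalue (orderStat (fun j => U N j ω)) ⟨1, h⟩| else 0)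
      =O[atTop] fun N : ℕ => √(Real.log N / N)) := by
  have key := ae_eventually_abs_eigenvalue_sub_le P W U G hG
  constructor
  · filter_upwards [key] with ω hω
    refine IsBigO.of_bound 84 ?_
    filter_upwards [hω] with N hN
    rw [Real.norm_of_nonneg (Real.iSup_nonneg fun _ => abs_nonneg _),
      Real.norm_of_nonneg (Real.sqrt_nonneg _)]
    exact Real.iSup_le hN (by positivity)
  · filter_upwards [key] with ω hω
    refine IsBigO.of_bound 84 ?_
    filter_upwards [hω, eventually_ge_atTop 2] with N hN h2
    rw [dif_pos h2, Real.norm_of_nonneg (abs_nonneg _), Real.norm_of_nonneg (Real.sqrt_nonneg _)]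
    exact hN _
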